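/- Let $M$ be a smooth closed connected surface of genus at least $2$, and let $\sigma$ be a hyperbolic metric on $M$, i.e. a smooth Riemannian metric of constant Gaussian curvature $-1$; let $A$ be its total area. Then for every $\varepsilon>0$ there is a smooth Riemannian metric $g$ on $M$ that is conformally equivalent to $\sigma$ (that is, $g=e^{2u}\sigma$ for some smooth function $u\colon M\to\mathbb R$), has total area $A$, and satisfies $$\operatorname{sys}(g)\le\varepsilon\qquad\text{and}\qquad \operatorname{diam}(M,g)\le 2\operatorname{diam}(M,\sigma).$$ Here $\operatorname{sys}(g)$, the systole, is the infimum of the $g$-lengths of the non-contractible closed $C^1$ curves in $M$, and $\operatorname{diam}(M,g)$ is the diameter of $M$ for the distance induced by $g$. (The surface may be orientable or not; the genus is the number of handles in the first case and the number of cross-caps in the second.) -/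

import Mathlib

open scoped Manifold ContDiff ENNReal Bundle

noncomputable section

namespace ClosedSurface

/-- The model of a surface: the Euclidean plane. -/
abbrev Plane : Type := EuclideanSpace ℝ (Fin 2)

/-- The standard basis vector `eᵢ` of the plane. -/
def basisVec (i : Fin 2) : Plane := EuclideanSpace.single i (1 : ℝ)

/-- Smooth Riemannian metrics on a smooth surface `M`. -/
abbrev Metric (M : Type*) [TopologicalSpace M] [ChartedSpace Plane M]
    [IsManifold (𝓡 2) ∞ M] : Type _ :=
  Bundle.ContMDiffRiemannianMetric (𝓡 2) ∞ Plane (fun x : M => TangentSpace (𝓡 2) x)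

/-! ### Gaussian curvature of a metric on an open subset of the plane

`G y` is the matrix `(g_{ij}(y))` of the metric in the coordinates. -/

/-- The `k`-th partial derivative of `f` at `y`. -/
def partialDeriv (k : Fin 2) (f : Plane → ℝ) (y : Plane) : ℝ :=
  fderiv ℝ f y (basisVec k)

/-- The Christoffel symbol `Γ^k_{ij}`. -/
def christoffel (G : Plane → Matrix (Fin 2) (Fin 2) ℝ) (k i j : Fin 2) (y : Plane) : ℝ :=
  (1 / 2) * ∑ l, (G y)⁻¹ k l *
    (partialDeriv i (fun z => G z j l) y + partialDeriv j (fun z => G z i l) y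
      - partialDeriv l (fun z => G z i j) y)

/-- The component along `∂_l` of `R(∂_i, ∂_j) ∂_k = ∇_i ∇_j ∂_k - ∇_j ∇_i ∂_k`. -/
def curvatureTensor (G : Plane → Matrix (Fin 2) (Fin 2) ℝ) (l i j k : Fin 2) (y : Plane) : ℝ :=
  partialDeriv i (christoffel G l j k) y - partialDeriv j (christoffel G l i k) y
    + ∑ m, (christoffel G l i m y * christoffel G m j k y
      - christoffel G l j m y * christoffel G m i k y)

/-- The Gaussian curvature `⟨R(∂₁, ∂₂) ∂₂, ∂₁⟩ / det (g_{ij})` (coordinates are numbered `0, 1`). -/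
def gaussianCurvature (G : Plane → Matrix (Fin 2) (Fin 2) ℝ) (y : Plane) : ℝ :=
  (∑ l, G y 0 l * curvatureTensor G l 0 1 1 y) / (G y).det

section Surface

variable {M : Type*} [TopologicalSpace M] [ChartedSpace Plane M]

/-- The coordinate vector field `∂_i` of the chart `chartAt Plane x`, at the point with
coordinates `y`. -/
def coordVec (x : M) (y : Plane) (i : Fin 2) :
    TangentSpace (𝓡 2) ((chartAt Plane x).symm y) :=
  mfderiv (𝓡 2) (𝓡 2) (chartAt Plane x).symm y (basisVec i)

section MetricNotions

variable [IsManifold (𝓡 2) ∞ M]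

/-- The matrix `g_{ij} = g(∂_i, ∂_j)` in the chart `chartAt Plane x`; it is meaningful on the
target of the chart. -/
def coeff (g : Metric M) (x : M) (y : Plane) : Matrix (Fin 2) (Fin 2) ℝ :=
  Matrix.of fun i j => g.inner ((chartAt Plane x).symm y) (coordVec x y i) (coordVec x y j)

/-- A hyperbolic metric: a metric of constant Gaussian curvature `-1`. -/
def IsHyperbolic (g : Metric M) : Prop :=
  ∀ x : M, ∀ y ∈ (chartAt Plane x).target, gaussianCurvature (coeff g x) y = -1

/-- `g` is conformally equivalent to `σ`: `g = e^{2u} σ` with `u` smooth. -/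
def IsConformal (g σ : Metric M) : Prop :=
  ∃ u : M → ℝ, ContMDiff (𝓡 2) 𝓘(ℝ, ℝ) ∞ u ∧
    ∀ (p : M) (v w : TangentSpace (𝓡 2) p),
      g.inner p v w = Real.exp (2 * u p) * σ.inner p v w

/-- The `g`-length of a curve parametrized by the unit interval. -/
def length (g : Metric M) {x y : M} (γ : Path x y) : ℝ≥0∞ :=
  letI : Bundle.RiemannianBundle (fun p : M => TangentSpace (𝓡 2) p) := ⟨g.toRiemannianMetric⟩
  ∫⁻ t, ‖mfderiv (𝓡∂ 1) (𝓡 2) γ t 1‖ₑ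

/-- The distance of `g`, the infimum of the `g`-lengths of the `C^1` curves between two points. -/
def riemannianDist (g : Metric M) (x y : M) : ℝ≥0∞ :=
  letI : Bundle.RiemannianBundle (fun p : M => TangentSpace (𝓡 2) p) := ⟨g.toRiemannianMetric⟩
  Manifold.riemannianEDist (𝓡 2) x y

/-- The diameter of `(M, g)`. -/
def diam (g : Metric M) : ℝ≥0∞ :=
  ⨆ (x : M) (y : M), riemannianDist g x y

/-- The systole of `(M, g)`: the infimum of the `g`-lengths of the `C^1` closed curves that are not
contractible (it is `∞` if there are none). -/
def systole (g : Metric M) : ℝ≥0∞ :=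
  ⨅ (x : M) (γ : Path x x) (_ : ContMDiff (𝓡∂ 1) (𝓡 2) 1 γ)
    (_ : ¬ Path.Homotopic γ (Path.refl x)), length g γ

variable (M) in
/-- A smooth partition of unity on `M`, indexed by the points of `M`, the function of index `x`
being supported in the domain of `chartAt Plane x`. -/
def chartPartition [T2Space M] [SigmaCompactSpace M] :
    SmoothPartitionOfUnity M (𝓡 2) M Set.univ :=
  (SmoothPartitionOfUnity.exists_isSubordinate (𝓡 2) isClosed_univ
    (fun x : M => (chartAt Plane x).source) (fun x => (chartAt Plane x).open_source)
    (fun x _ => Set.mem_iUnion.2 ⟨x, mem_chart_source Plane x⟩)).choose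

/-- The area of `(M, g)`, i.e. the integral of `1` for the Riemannian measure `√(det g_{ij}) dy`.
As usual it is computed chart by chart with a partition of unity, on which it does not depend. -/
def area [T2Space M] [SigmaCompactSpace M] (g : Metric M) : ℝ≥0∞ :=
  ∑' x : M, ∫⁻ y in (chartAt Plane x).target,
    ENNReal.ofReal (chartPartition M x ((chartAt Plane x).symm y) *
      Real.sqrt (coeff g x y).det)

end MetricNotions

variable (M)

/-- `M` is orientable: it is covered by smooth charts whose transition maps have positive Jacobian
determinants. -/
def Orientable : Prop :=
  ∃ A ⊆ IsManifold.maximalAtlas (𝓡 2) ∞ M,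
    (∀ p : M, ∃ e ∈ A, p ∈ e.source) ∧
    ∀ e ∈ A, ∀ e' ∈ A, ∀ y ∈ (e.symm.trans e').source,
      0 < (fderiv ℝ (fun z : Plane => e' (e.symm z)) y).det

/-- The first Betti number with coefficients in the field with two elements of a connected `M`:
the dimension of `H¹(M; 𝔽₂) = Hom(π₁(M), 𝔽₂)`. -/
def bettiOne [Nonempty M] : ℕ :=
  Module.finrank (ZMod 2)
    (Additive (FundamentalGroup M (Classical.arbitrary M)) →+ ZMod 2)

open Classical in
/-- The genus of a closed connected surface: half of the first Betti number (the number of handles)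
if the surface is orientable, and the first Betti number with coefficients in `𝔽₂` (the number of
cross-caps) if it is not. -/
def genus [Nonempty M] : ℕ :=
  if Orientable M then bettiOne M / 2 else bettiOne M

end Surface

end ClosedSurface

end

/-! A curve has area zero, so a conformal factor can be made tiny along one curve at almost no cost
in area. Genus at least `2` gives a non-contractible loop (`exists_loop_not_homotopic`), which is
homotopic to a `C^1` loop of finite `σ`-length `L` (`hasSmoothRep`, `length_lt_top`). Let `f ≤ 1` be
a smooth positive factor equal to `η ^ 2` on the loop, with `f σ` keeping at least a quarter of the
area of `σ` (`exists_pinching_factor`). Then `g = k f σ` has the area of `σ` for some `k ≤ 4`.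

Lengths scale by the square root of the factor. Since `k f ≤ 4` everywhere, distances at most
double; since `k f ≤ 4 η ^ 2` on the loop, its length is at most `2 η L`, which is at most `ε` for
small `η`. The existence of `f` is monotone convergence: factors increasing to `1` off the curve
have areas tending to that of `σ` (`tendsto_area_scale`). -/

noncomputable section

/-! ### Conformal scaling: lengths, distances, diameter. -/

namespace ClosedSurface

open MeasureTheory Set

section Scaling

variable {M : Type*} [TopologicalSpace M] [ChartedSpace Plane M] [IsManifold (𝓡 2) ∞ M]

set_option synthInstance.maxHeartbeats 200000 in
/-- The metric `f σ` for a positive smooth function `f`. -/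
def scale (σ : Metric M) (f : M → ℝ) (hf : ContMDiff (𝓡 2) 𝓘(ℝ, ℝ) ∞ f) (hpos : ∀ p, 0 < f p) :
    Metric M where
  inner p := f p • σ.inner p
  symm p v w := by
    change f p * σ.inner p v w = f p * σ.inner p w v
    rw [σ.symm]
  pos p v hv := by
    change 0 < f p * σ.inner p v v
    exact mul_pos (hpos p) (σ.pos p v hv)
  isVonNBounded p := by
    -- The unit ball of `f p • σ` is the unit ball of `σ` shrunk by `1 / √(f p)`.
    refine ((σ.isVonNBounded p).image
      ((Real.sqrt (f p))⁻¹ • ContinuousLinearMap.id ℝ (TangentSpace (𝓡 2) p))).subset ?_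
    intro v hv
    have hs : 0 < Real.sqrt (f p) := Real.sqrt_pos.2 (hpos p)
    refine ⟨Real.sqrt (f p) • v, ?_, ?_⟩
    · have h1 : f p * σ.inner p v v < 1 := hv
      change σ.inner p (Real.sqrt (f p) • v) (Real.sqrt (f p) • v) < 1
      rw [map_smul, map_smul]
      change Real.sqrt (f p) * (Real.sqrt (f p) * σ.inner p v v) < 1
      rwa [← mul_assoc, Real.mul_self_sqrt (hpos p).le]
    · change (Real.sqrt (f p))⁻¹ • (Real.sqrt (f p) • v) = v
      rw [inv_smul_smul₀ hs.ne']
  contMDiff := hf.smul_section (V := fun x : M => TangentSpace (𝓡 2) x →L[ℝ]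
    TangentSpace (𝓡 2) x →L[ℝ] ℝ) σ.contMDiff

lemma scale_inner (σ : Metric M) (f : M → ℝ) (hf : ContMDiff (𝓡 2) 𝓘(ℝ, ℝ) ∞ f)
    (hpos : ∀ p, 0 < f p) (p : M) (v w : TangentSpace (𝓡 2) p) :
    (scale σ f hf hpos).inner p v w = f p * σ.inner p v w := rfl

lemma isConformal_scale (σ : Metric M) (f : M → ℝ) (hf : ContMDiff (𝓡 2) 𝓘(ℝ, ℝ) ∞ f)
    (hpos : ∀ p, 0 < f p) : IsConformal (scale σ f hf hpos) σ := by
  refine ⟨fun p => Real.log (f p) / 2, ?_, fun p v w => ?_⟩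
  · intro p
    have h : ContDiffAt ℝ ∞ (fun t : ℝ => Real.log t / 2) (f p) :=
      (Real.contDiffAt_log.2 (hpos p).ne').div_const 2
    exact h.contMDiffAt.comp p (hf p)
  · rw [scale_inner, mul_div_cancel₀ _ two_ne_zero, Real.exp_log (hpos p)]

lemma length_eq_lintegral (g : Metric M) {x y : M} (γ : Path x y) :
    length g γ = ∫⁻ t, ENNReal.ofReal (Real.sqrt (g.inner (γ t)
      (mfderiv (𝓡∂ 1) (𝓡 2) γ t 1) (mfderiv (𝓡∂ 1) (𝓡 2) γ t 1))) := by
  let _ : Bundle.RiemannianBundle (fun p : M => TangentSpace (𝓡 2) p) := ⟨g.toRiemannianMetric⟩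
  change ∫⁻ t, ‖mfderiv (𝓡∂ 1) (𝓡 2) γ t 1‖ₑ = _
  refine lintegral_congr fun t => ?_
  rw [← ofReal_norm, norm_eq_sqrt_real_inner]
  rfl

lemma riemannianDist_eq_iInf (g : Metric M) (x y : M) :
    riemannianDist g x y =
      ⨅ (γ : Path x y) (_ : ContMDiff (𝓡∂ 1) (𝓡 2) 1 γ), length g γ := by
  rw [riemannianDist, Manifold.riemannianEDist]
  rfl

lemma systole_le_length (g : Metric M) {x : M} {γ : Path x x} (hγ : ContMDiff (𝓡∂ 1) (𝓡 2) 1 γ)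
    (h : ¬ Path.Homotopic γ (Path.refl x)) : systole g ≤ length g γ :=
  iInf_le_of_le x <| iInf_le_of_le γ <| iInf_le_of_le hγ <| iInf_le_of_le h le_rfl

lemma length_scale_le (σ : Metric M) (f : M → ℝ) (hf : ContMDiff (𝓡 2) 𝓘(ℝ, ℝ) ∞ f)
    (hpos : ∀ p, 0 < f p) {x y : M} (γ : Path x y) {c : ℝ} (hc : 0 ≤ c)
    (h : ∀ t, f (γ t) ≤ c ^ 2) :
    length (scale σ f hf hpos) γ ≤ ENNReal.ofReal c * length σ γ := by
  rw [length_eq_lintegral, length_eq_lintegral, ← lintegral_const_mul' _ _ ENNReal.ofReal_ne_top]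
  refine lintegral_mono fun t => ?_
  rw [← ENNReal.ofReal_mul hc, scale_inner, Real.sqrt_mul (hpos _).le]
  refine ENNReal.ofReal_le_ofReal (mul_le_mul_of_nonneg_right ?_ (Real.sqrt_nonneg _))
  exact Real.sqrt_le_iff.2 ⟨hc, h t⟩

lemma diam_scale_le (σ : Metric M) (f : M → ℝ) (hf : ContMDiff (𝓡 2) 𝓘(ℝ, ℝ) ∞ f)
    (hpos : ∀ p, 0 < f p) {c : ℝ} (hc : 0 < c) (h : ∀ p, f p ≤ c ^ 2) :
    diam (scale σ f hf hpos) ≤ ENNReal.ofReal c * diam σ := by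
  refine iSup₂_le fun x y => ?_
  refine le_trans ?_ (mul_le_mul_right (le_iSup₂ (f := fun x y => riemannianDist σ x y) x y) _)
  -- A factor that is neither `0` nor `∞` commutes with infima in `ℝ≥0∞`, even over an empty family
  -- of curves.
  have hc0 : ENNReal.ofReal c ≠ 0 := by simpa using hc
  rw [riemannianDist_eq_iInf, riemannianDist_eq_iInf, ENNReal.mul_iInf_of_ne hc0 (by simp)]
  refine le_iInf fun γ => ?_
  rw [ENNReal.mul_iInf_of_ne hc0 (by simp)]
  refine le_iInf fun hγ => ?_
  exact (iInf₂_le γ hγ).trans (length_scale_le σ f hf hpos γ hc.le fun t => h _)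

lemma continuousOn_inner (g : Metric M) {X : Type*} [TopologicalSpace X] {s : Set X} {b : X → M}
    {v w : ∀ x, TangentSpace (𝓡 2) (b x)}
    (hv : ContinuousOn (fun x => (⟨b x, v x⟩ : TangentBundle (𝓡 2) M)) s)
    (hw : ContinuousOn (fun x => (⟨b x, w x⟩ : TangentBundle (𝓡 2) M)) s) :
    ContinuousOn (fun x => g.inner (b x) (v x) (w x)) s := by
  let _ : Bundle.RiemannianBundle (fun p : M => TangentSpace (𝓡 2) p) := ⟨g.toRiemannianMetric⟩
  have : IsContinuousRiemannianBundle Plane (fun p : M => TangentSpace (𝓡 2) p) :=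
    ⟨g.inner, g.contMDiff.continuous, fun _ _ _ => rfl⟩
  exact ContinuousOn.inner_bundle (F := Plane) hv hw

/-- A path with a `C^1` extension to the real line has finite length. -/
lemma length_lt_top (g : Metric M) {x y : M} (γ : Path x y) {c : ℝ → M}
    (hc : ContMDiff 𝓘(ℝ, ℝ) (𝓡 2) 1 c) (h : ∀ t : unitInterval, γ t = c t) :
    length g γ < ⊤ := by
  let _ : Bundle.RiemannianBundle (fun p : M => TangentSpace (𝓡 2) p) := ⟨g.toRiemannianMetric⟩
  have : IsManifold (𝓡 2) 1 M := IsManifold.of_le (n := ∞) (by simp)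
  have h1 : length g γ = Manifold.pathELength (𝓡 2) c 0 1 := by
    change ∫⁻ t, ‖mfderiv (𝓡∂ 1) (𝓡 2) γ t 1‖ₑ = _
    rw [Manifold.lintegral_norm_mfderiv_Icc_eq_pathELength_projIcc]
    refine Manifold.pathELength_congr fun t ht => ?_
    rw [Function.comp_apply, projIcc_of_mem _ ht, h]
  rw [h1, Manifold.pathELength_eq_lintegral_mfderiv_Icc]
  -- The velocity is continuous on the line, so the speed is bounded on `[0, 1]`.
  have h2 : Continuous fun t : ℝ =>
      (⟨c t, mfderiv 𝓘(ℝ, ℝ) (𝓡 2) c t 1⟩ : TangentBundle (𝓡 2) M) := by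
    have h3 : Continuous fun t : ℝ => (⟨t, 1⟩ : TangentBundle 𝓘(ℝ, ℝ) ℝ) :=
      (tangentBundleModelSpaceHomeomorph 𝓘(ℝ, ℝ)).symm.continuous.comp
        (continuous_id.prodMk continuous_const)
    exact (hc.continuous_tangentMap le_rfl).comp h3
  have h4 : Continuous fun t : ℝ => ‖mfderiv 𝓘(ℝ, ℝ) (𝓡 2) c t 1‖ := by
    simp_rw [norm_eq_sqrt_real_inner]
    exact (continuousOn_univ.1 (continuousOn_inner g h2.continuousOn h2.continuousOn)).sqrt
  obtain ⟨C, hC⟩ := (isCompact_Icc (a := (0 : ℝ)) (b := 1)).bddAbove_image h4.continuousOn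
  refine lt_of_le_of_lt (setLIntegral_mono' (g := fun _ => ENNReal.ofReal C) measurableSet_Icc
    fun t ht => ?_) ?_
  · rw [← ofReal_norm]
    exact ENNReal.ofReal_le_ofReal (hC (mem_image_of_mem _ ht))
  · simp

end Scaling

end ClosedSurface

/-! ### Area of conformal metrics. -/

namespace ClosedSurface

open MeasureTheory Set Filter Topology

section Area

variable {M : Type*} [TopologicalSpace M] [ChartedSpace Plane M] [IsManifold (𝓡 2) ∞ M]

lemma coeff_scale (σ : Metric M) (f : M → ℝ) (hf : ContMDiff (𝓡 2) 𝓘(ℝ, ℝ) ∞ f)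
    (hpos : ∀ p, 0 < f p) (x : M) (y : Plane) :
    coeff (scale σ f hf hpos) x y = f ((chartAt Plane x).symm y) • coeff σ x y := by
  ext i j
  rfl

lemma continuousOn_sqrt_det_coeff (σ : Metric M) (x : M) :
    ContinuousOn (fun y => Real.sqrt (coeff σ x y).det) (chartAt Plane x).target := by
  have : IsManifold (𝓡 2) 1 M := IsManifold.of_le (n := ∞) (by simp)
  have hopen := (chartAt Plane x).open_target
  have hvec (i : Fin 2) : ContinuousOn (fun y =>
      (⟨(chartAt Plane x).symm y, coordVec x y i⟩ : TangentBundle (𝓡 2) M))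
      (chartAt Plane x).target := by
    have h1 : ContMDiffOn (𝓡 2) (𝓡 2) 1 (chartAt Plane x).symm (chartAt Plane x).target :=
      contMDiffOn_chart_symm
    have h2 := h1.continuousOn_tangentMapWithin le_rfl hopen.uniqueMDiffOn
    have h3 : Continuous fun y : Plane => (⟨y, basisVec i⟩ : TangentBundle (𝓡 2) Plane) :=
      (tangentBundleModelSpaceHomeomorph (𝓡 2)).symm.continuous.comp
        (continuous_id.prodMk continuous_const)
    refine (h2.comp h3.continuousOn fun y hy => hy).congr fun y hy => ?_
    simp only [Function.comp_apply, tangentMapWithin, coordVec,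
      mfderivWithin_of_isOpen hopen hy]
  have hco (i j : Fin 2) : ContinuousOn (fun y => coeff σ x y i j) (chartAt Plane x).target :=
    continuousOn_inner σ (hvec i) (hvec j)
  simp_rw [Matrix.det_fin_two]
  exact (((hco 0 0).mul (hco 1 1)).sub ((hco 0 1).mul (hco 1 0))).sqrt

variable [T2Space M] [SigmaCompactSpace M]

/-- The contribution of the chart at `x` to the density of the area of `σ`. -/
def areaDensity (σ : Metric M) (x : M) (y : Plane) : ℝ≥0∞ :=
  ENNReal.ofReal (chartPartition M x ((chartAt Plane x).symm y) * Real.sqrt (coeff σ x y).det)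

lemma area_scale (σ : Metric M) (f : M → ℝ) (hf : ContMDiff (𝓡 2) 𝓘(ℝ, ℝ) ∞ f)
    (hpos : ∀ p, 0 < f p) :
    area (scale σ f hf hpos) = ∑' x : M, ∫⁻ y in (chartAt Plane x).target,
      ENNReal.ofReal (f ((chartAt Plane x).symm y)) * areaDensity σ x y := by
  refine tsum_congr fun x => lintegral_congr fun y => ?_
  have h := (hpos ((chartAt Plane x).symm y)).le
  rw [areaDensity, ← ENNReal.ofReal_mul h, coeff_scale, Matrix.det_smul, Fintype.card_fin,
    Real.sqrt_mul (by positivity), Real.sqrt_sq h, mul_left_comm]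

lemma area_scale_const_mul (σ : Metric M) (f : M → ℝ) (hf : ContMDiff (𝓡 2) 𝓘(ℝ, ℝ) ∞ f)
    (hpos : ∀ p, 0 < f p) {k : ℝ} (hk : 0 < k) (hf' : ContMDiff (𝓡 2) 𝓘(ℝ, ℝ) ∞ fun p => k * f p)
    (hpos' : ∀ p, 0 < k * f p) :
    area (scale σ (fun p => k * f p) hf' hpos') = ENNReal.ofReal k * area (scale σ f hf hpos) := by
  rw [area_scale, area_scale, ← ENNReal.tsum_mul_left]
  refine tsum_congr fun x => ?_
  rw [← lintegral_const_mul' _ _ ENNReal.ofReal_ne_top]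
  refine lintegral_congr fun y => ?_
  rw [ENNReal.ofReal_mul hk.le, mul_assoc]

lemma area_scale_le (σ : Metric M) (f : M → ℝ) (hf : ContMDiff (𝓡 2) 𝓘(ℝ, ℝ) ∞ f)
    (hpos : ∀ p, 0 < f p) (hle : ∀ p, f p ≤ 1) : area (scale σ f hf hpos) ≤ area σ := by
  rw [area_scale]
  refine ENNReal.tsum_le_tsum fun x => lintegral_mono fun y => ?_
  refine mul_le_of_le_one_left' ?_
  simpa using hle _

lemma chartPartition_isSubordinate :
    (chartPartition M).IsSubordinate fun x : M => (chartAt Plane x).source :=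
  (SmoothPartitionOfUnity.exists_isSubordinate (𝓡 2) isClosed_univ
    (fun x : M => (chartAt Plane x).source) (fun x => (chartAt Plane x).open_source)
    (fun x _ => Set.mem_iUnion.2 ⟨x, mem_chart_source Plane x⟩)).choose_spec

lemma continuousOn_areaDensity (σ : Metric M) (x : M) :
    ContinuousOn (areaDensity σ x) (chartAt Plane x).target := by
  refine ENNReal.continuous_ofReal.comp_continuousOn (ContinuousOn.mul ?_
    (continuousOn_sqrt_det_coeff σ x))
  exact (chartPartition M x).contMDiff.continuous.comp_continuousOn
    (chartAt Plane x).continuousOn_symm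

lemma finite_chartPartition_ne_zero [CompactSpace M] :
    {x : M | (Function.support (chartPartition M x)).Nonempty}.Finite :=
  (chartPartition M).locallyFinite.finite_nonempty_of_compact

lemma areaDensity_eq_zero (σ : Metric M) {x : M}
    (hx : ¬ (Function.support (chartPartition M x)).Nonempty) (y : Plane) :
    areaDensity σ x y = 0 := by
  have : chartPartition M x ((chartAt Plane x).symm y) = 0 := by
    by_contra h
    exact hx ⟨_, h⟩
  simp [areaDensity, this]

/-- The partition function has compact support inside the chart domain, so the density vanishes off
a compact set, on which it is bounded. -/
lemma lintegral_areaDensity_lt_top [CompactSpace M] (σ : Metric M) (x : M) :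
    ∫⁻ y in (chartAt Plane x).target, areaDensity σ x y < ⊤ := by
  set e := chartAt Plane x
  set K : Set Plane := e '' tsupport (chartPartition M x)
  have hsub : tsupport (chartPartition M x) ⊆ e.source := chartPartition_isSubordinate x
  have hK : IsCompact K :=
    (isClosed_tsupport _).isCompact.image_of_continuousOn (e.continuousOn.mono hsub)
  have hKt : K ⊆ e.target := by
    rintro _ ⟨p, hp, rfl⟩
    exact e.map_source (hsub hp)
  obtain ⟨C, hC⟩ := hK.bddAbove_image ((continuousOn_sqrt_det_coeff σ x).mono hKt)
  have hbound : ∀ y ∈ e.target, areaDensity σ x y ≤ K.indicator (fun _ => ENNReal.ofReal C) y := by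
    intro y hy
    by_cases hyK : y ∈ K
    · rw [indicator_of_mem hyK]
      refine ENNReal.ofReal_le_ofReal ((mul_le_of_le_one_left (Real.sqrt_nonneg _)
        ((chartPartition M).le_one x _)).trans (hC (mem_image_of_mem _ hyK)))
    · have : chartPartition M x (e.symm y) = 0 := by
        by_contra h
        exact hyK ⟨e.symm y, subset_tsupport _ h, e.right_inv hy⟩
      simp [areaDensity, e, this]
  refine (setLIntegral_mono' e.open_target.measurableSet hbound).trans_lt ?_
  refine (setLIntegral_le_lintegral _ _).trans_lt ?_
  rw [lintegral_indicator hK.isClosed.measurableSet, setLIntegral_const]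
  exact ENNReal.mul_lt_top ENNReal.ofReal_lt_top hK.measure_lt_top

lemma area_lt_top [CompactSpace M] (σ : Metric M) : area σ < ⊤ := by
  have hfin := finite_chartPartition_ne_zero (M := M)
  change ∑' x : M, ∫⁻ y in (chartAt Plane x).target, areaDensity σ x y < ⊤
  rw [tsum_eq_sum (s := hfin.toFinset)]
  · exact ENNReal.sum_lt_top.2 fun x _ => lintegral_areaDensity_lt_top σ x
  · intro x hx
    simp [areaDensity_eq_zero σ (by simpa using hx)]

/-- Continuity of the area along a monotone sequence of conformal factors that tends to one outside
of a set which is null in every chart. -/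
lemma tendsto_area_scale [CompactSpace M] (σ : Metric M) (f : ℕ → M → ℝ)
    (hf : ∀ n, ContMDiff (𝓡 2) 𝓘(ℝ, ℝ) ∞ (f n)) (hpos : ∀ n p, 0 < f n p)
    (hmono : ∀ p, Monotone fun n => f n p) {K : Set M}
    (hK : ∀ x : M, volume ((chartAt Plane x).target ∩ (chartAt Plane x).symm ⁻¹' K) = 0)
    (hlim : ∀ p ∉ K, Tendsto (fun n => f n p) atTop (𝓝 1)) :
    Tendsto (fun n => area (scale σ (f n) (hf n) (hpos n))) atTop (𝓝 (area σ)) := by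
  have hfin := finite_chartPartition_ne_zero (M := M)
  -- By compactness only finitely many partition functions are nonzero; the limit can then be taken
  -- term by term, by monotone convergence.
  have hsum (g : M → Plane → ℝ≥0∞) : (∑' x : M, ∫⁻ y in (chartAt Plane x).target,
      g x y * areaDensity σ x y) = ∑ x ∈ hfin.toFinset, ∫⁻ y in (chartAt Plane x).target,
      g x y * areaDensity σ x y := by
    refine tsum_eq_sum fun x hx => ?_
    simp [areaDensity_eq_zero σ (x := x) (by simpa using hx)]
  have harea : area σ = ∑' x : M, ∫⁻ y in (chartAt Plane x).target,
      (fun _ _ => (1 : ℝ≥0∞)) x y * areaDensity σ x y := by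
    simp only [one_mul]
    rfl
  rw [harea, hsum]
  simp_rw [area_scale]
  have hsum' (n : ℕ) := hsum fun x y => ENNReal.ofReal (f n ((chartAt Plane x).symm y))
  simp_rw [hsum']
  refine tendsto_finsetSum _ fun x _ => ?_
  have hmeas := (chartAt Plane x).open_target.measurableSet
  refine lintegral_tendsto_of_tendsto_of_monotone (fun n => ?_) ?_ ?_
  · refine AEMeasurable.mul (ContinuousOn.aemeasurable ?_ hmeas)
      ((continuousOn_areaDensity σ x).aemeasurable hmeas)
    exact ENNReal.continuous_ofReal.comp_continuousOn
      ((hf n).continuous.comp_continuousOn (chartAt Plane x).continuousOn_symm)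
  · exact Eventually.of_forall fun y m n hmn =>
      mul_le_mul_left (ENNReal.ofReal_le_ofReal (hmono _ hmn)) _
  · rw [ae_restrict_iff' hmeas]
    refine measure_mono_null (fun y hy => ?_) (hK x)
    by_contra hy'
    refine hy fun hyt => ?_
    have h1 := hlim ((chartAt Plane x).symm y) fun h => hy' ⟨hyt, h⟩
    refine ENNReal.Tendsto.mul_const ?_ (Or.inl one_ne_zero)
    simpa using ENNReal.tendsto_ofReal h1

end Area

end ClosedSurface

/-! ### Curves are null sets. -/

namespace ClosedSurface

open MeasureTheory Set Filter Topology

/-- Composed with the first coordinate, `γ` becomes a map from part of the plane to the plane, and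
its image is already attained on a subset of the first axis. That axis is null, and differentiable
maps between spaces of equal dimension preserve null sets. -/
lemma volume_image_curve_eq_zero {γ : ℝ → Plane} {s : Set ℝ} (h : DifferentiableOn ℝ γ s) :
    volume (γ '' s) = 0 := by
  let p : Plane →L[ℝ] ℝ := EuclideanSpace.proj 0
  let L : Submodule ℝ Plane := LinearMap.ker (EuclideanSpace.proj (𝕜 := ℝ) (1 : Fin 2)).toLinearMap
  have hL : volume (L : Set Plane) = 0 := by
    refine Measure.addHaar_submodule _ _ fun htop => ?_
    have : basisVec 1 ∈ L := htop ▸ Submodule.mem_top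
    simp [L, basisVec] at this
  have hT : volume ((L : Set Plane) ∩ p ⁻¹' s) = 0 := measure_mono_null inter_subset_left hL
  refine measure_mono_null ?_ (addHaar_image_eq_zero_of_differentiableOn_of_addHaar_eq_zero volume
    (h.comp p.differentiableOn fun _ hy => hy.2) hT)
  rintro _ ⟨t, ht, rfl⟩
  refine ⟨t • basisVec 0, ⟨?_, ?_⟩, ?_⟩
  · simp [L, basisVec]
  · simpa [p, basisVec] using ht
  · simp [p, basisVec]

variable {M : Type*} [TopologicalSpace M] [ChartedSpace Plane M] [IsManifold (𝓡 2) ∞ M]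

/-- A `C^1` curve is a null set in every chart. -/
lemma volume_chart_preimage_range_eq_zero {c : ℝ → M} (hc : ContMDiff 𝓘(ℝ, ℝ) (𝓡 2) 1 c) (x : M) :
    volume ((chartAt Plane x).target ∩ (chartAt Plane x).symm ⁻¹' range c) = 0 := by
  have : IsManifold (𝓡 2) 1 M := IsManifold.of_le (n := ∞) (by simp)
  set e := chartAt Plane x
  have h1 : ContMDiffOn 𝓘(ℝ, ℝ) (𝓡 2) 1 (e ∘ c) (c ⁻¹' e.source) :=
    (contMDiffOn_chart (I := 𝓡 2) (n := 1) (x := x)).comp hc.contMDiffOn fun _ h => h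
  have h2 : DifferentiableOn ℝ (e ∘ c) (c ⁻¹' e.source) :=
    (contMDiffOn_iff_contDiffOn.1 h1).differentiableOn one_ne_zero
  refine measure_mono_null ?_ (volume_image_curve_eq_zero h2)
  rintro y ⟨hy, t, ht⟩
  refine ⟨t, ?_, ?_⟩
  · simpa [ht] using e.map_target hy
  · simp [ht, e.right_inv hy]

end ClosedSurface

/-! ### Smoothing paths up to homotopy. -/

namespace ClosedSurface

open Set Filter Topology unitInterval

section SmoothPaths

variable {M : Type*} [TopologicalSpace M] [ChartedSpace Plane M]

/-- The path `p` is homotopic to a path with a `C^1` extension to the real line. -/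
def HasSmoothRep {x y : M} (p : Path x y) : Prop :=
  ∃ (q : Path x y) (c : ℝ → M), ContMDiff 𝓘(ℝ, ℝ) (𝓡 2) 1 c ∧ (∀ t : I, q t = c t) ∧ q.Homotopic p

lemma HasSmoothRep.congr {x y : M} {p p' : Path x y} (h : HasSmoothRep p) (hp : p.Homotopic p') :
    HasSmoothRep p' := by
  obtain ⟨q, c, hc, hq, hqp⟩ := h
  exact ⟨q, c, hc, hq, hqp.trans hp⟩

lemma HasSmoothRep.of_cast {x y x' y' : M} {p : Path x y} {hx : x' = x} {hy : y' = y}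
    (h : HasSmoothRep (p.cast hx hy)) : HasSmoothRep p := by
  subst hx hy
  exact h

lemma hasSmoothRep_refl (x : M) : HasSmoothRep (Path.refl x) :=
  ⟨Path.refl x, fun _ => x, contMDiff_const, fun _ => rfl, Path.Homotopic.refl _⟩

/-- A smooth step, equal to `0` on `(-∞, 1/3]` and to `1` on `[2/3, ∞)`. -/
def smoothStep (t : ℝ) : ℝ := Real.smoothTransition (3 * t - 1)

lemma contDiff_smoothStep {n : ℕ∞} : ContDiff ℝ n smoothStep :=
  Real.smoothTransition.contDiff.comp (by fun_prop)

lemma smoothStep_of_le {t : ℝ} (h : t ≤ 1 / 3) : smoothStep t = 0 :=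
  Real.smoothTransition.zero_of_nonpos (by linarith)

lemma smoothStep_of_ge {t : ℝ} (h : 2 / 3 ≤ t) : smoothStep t = 1 :=
  Real.smoothTransition.one_of_one_le (by linarith)

lemma smoothStep_mem (t : ℝ) : smoothStep t ∈ I :=
  ⟨Real.smoothTransition.nonneg _, Real.smoothTransition.le_one _⟩

/-- A path with a `C^1` representative has one that is constant near its endpoints. -/
lemma HasSmoothRep.exists_flat {x y : M} {p : Path x y} (h : HasSmoothRep p) :
    ∃ (q : Path x y) (c : ℝ → M), ContMDiff 𝓘(ℝ, ℝ) (𝓡 2) 1 c ∧ (∀ t : I, q t = c t) ∧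
      q.Homotopic p ∧ (∀ t ≤ 1 / 3, c t = x) ∧ (∀ t, 2 / 3 ≤ t → c t = y) := by
  obtain ⟨q, c, hc, hq, hqp⟩ := h
  let s : I → I := fun t => ⟨smoothStep t, smoothStep_mem _⟩
  have hs : Continuous s :=
    ((contDiff_smoothStep (n := 0)).continuous.comp continuous_subtype_val).subtype_mk _
  have hs0 : s 0 = 0 := Subtype.ext (smoothStep_of_le (by norm_num))
  have hs1 : s 1 = 1 := Subtype.ext (smoothStep_of_ge (by norm_num))
  have hc0 : c 0 = x := by simpa using (hq 0).symm
  have hc1 : c 1 = y := by simpa using (hq 1).symm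
  refine ⟨q.reparam s hs hs0 hs1, c ∘ smoothStep,
    hc.comp (contMDiff_iff_contDiff.2 (contDiff_smoothStep (n := 1))), fun t => hq (s t),
    Path.Homotopic.trans ⟨(Path.Homotopy.reparam q s hs hs0 hs1).symm⟩ hqp, ?_, ?_⟩
  · intro t ht
    simp [smoothStep_of_le ht, hc0]
  · intro t ht
    simp [smoothStep_of_ge ht, hc1]

/-- Representatives constant near their endpoints concatenate without a corner. -/
lemma HasSmoothRep.trans {x y z : M} {p : Path x y} {q : Path y z} (hp : HasSmoothRep p)
    (hq : HasSmoothRep q) : HasSmoothRep (p.trans q) := by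
  obtain ⟨p', c, hc, hpc, hp', -, hc1⟩ := hp.exists_flat
  obtain ⟨q', d, hd, hqd, hq', hd0, -⟩ := hq.exists_flat
  let a : ℝ → M := fun t => if t ≤ 1 / 2 then c (2 * t) else d (2 * t - 1)
  refine ⟨p'.trans q', a, fun t => ?_, fun t => ?_, hp'.hcomp hq'⟩
  · rcases lt_or_ge t (2 / 3) with ht | ht
    · have h1 : ContMDiff 𝓘(ℝ, ℝ) (𝓡 2) 1 fun t : ℝ => c (2 * t) :=
        hc.comp (contMDiff_iff_contDiff.2 (by fun_prop))
      refine (h1 t).congr_of_eventuallyEq ?_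
      filter_upwards [Iio_mem_nhds ht] with u hu
      simp only [a]
      split_ifs with h
      · rfl
      · rw [hd0 _ (by linarith [mem_Iio.1 hu]), hc1 _ (by linarith)]
    · have h1 : ContMDiff 𝓘(ℝ, ℝ) (𝓡 2) 1 fun t : ℝ => d (2 * t - 1) :=
        hd.comp (contMDiff_iff_contDiff.2 (by fun_prop))
      refine (h1 t).congr_of_eventuallyEq ?_
      filter_upwards [Ioi_mem_nhds (show 1 / 2 < t by linarith)] with u hu
      simp only [a]
      rw [if_neg (not_le.2 hu)]
  · rw [Path.trans_apply]
    simp only [a]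
    split_ifs with h
    · exact hpc _
    · exact hqd _

/-- A path with image in a convex set of a chart has a `C^1` representative. -/
lemma hasSmoothRep_of_chart [IsManifold (𝓡 2) ∞ M] (x₀ : M) {s : Set Plane} (hs : Convex ℝ s)
    (hst : s ⊆ (chartAt Plane x₀).target) {x y : M} (p : Path x y)
    (hp : ∀ t, p t ∈ (chartAt Plane x₀).source ∧ chartAt Plane x₀ (p t) ∈ s) :
    HasSmoothRep p := by
  have : IsManifold (𝓡 2) 1 M := IsManifold.of_le (n := ∞) (by simp)
  set e := chartAt Plane x₀
  have hx : e x ∈ s := by simpa using (hp 0).2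
  have hy : e y ∈ s := by simpa using (hp 1).2
  have hx' : e.symm (e x) = x := e.left_inv (by simpa using (hp 0).1)
  have hy' : e.symm (e y) = y := e.left_inv (by simpa using (hp 1).1)
  -- The smooth step takes values in `[0, 1]`, so the curve stays on the segment, hence in `s`, for
  -- every real time.
  let b : ℝ → Plane := fun t => AffineMap.lineMap (e x) (e y) (smoothStep t)
  have hb : ContDiff ℝ 1 b := by
    have := contDiff_smoothStep (n := 1)
    simp only [b, AffineMap.lineMap_apply, vsub_eq_sub, vadd_eq_add]
    exact (this.smul contDiff_const).add contDiff_const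
  have hbs (t : ℝ) : b t ∈ s := hs.lineMap_mem hx hy (smoothStep_mem t)
  have hb0 : b 0 = e x := by simp [b, smoothStep_of_le (show (0 : ℝ) ≤ 1 / 3 by norm_num)]
  have hb1 : b 1 = e y := by simp [b, smoothStep_of_ge (show (2 / 3 : ℝ) ≤ 1 by norm_num)]
  have hc : ContMDiff 𝓘(ℝ, ℝ) (𝓡 2) 1 (e.symm ∘ b) :=
    have h : ContMDiffOn (𝓡 2) (𝓡 2) 1 e.symm e.target := contMDiffOn_chart_symm
    h.comp_contMDiff (contMDiff_iff_contDiff.2 hb) fun t => hst (hbs t)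
  let q : Path x y :=
    { toFun := fun t => e.symm (b t)
      continuous_toFun := hc.continuous.comp continuous_subtype_val
      source' := by simp [hb0, hx']
      target' := by simp [hb1, hy'] }
  refine ⟨q, e.symm ∘ b, hc, fun t => rfl, ⟨?_⟩⟩
  -- Straight-line homotopy in the chart; convexity keeps it in `s`.
  let F : I × I → Plane := fun z => AffineMap.lineMap (b z.2) (e (p z.2)) (z.1 : ℝ)
  have hF (z : I × I) : F z ∈ s := hs.lineMap_mem (hbs _) (hp _).2 z.1.2
  have hep : Continuous fun t : I => e (p t) :=
    e.continuousOn.comp_continuous p.continuous fun t => (hp t).1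
  have hFc : Continuous F := by
    have h1 : Continuous fun z : I × I => b z.2 :=
      hb.continuous.comp (continuous_subtype_val.comp continuous_snd)
    have h2 : Continuous fun z : I × I => e (p z.2) := hep.comp continuous_snd
    simp only [F, AffineMap.lineMap_apply, vsub_eq_sub, vadd_eq_add]
    exact ((continuous_subtype_val.comp continuous_fst).smul (h2.sub h1)).add h1
  exact
    { toFun := fun z => e.symm (F z)
      continuous_toFun := e.continuousOn_symm.comp_continuous hFc fun z => hst (hF z)
      map_zero_left := fun t => by simp [F, q]
      map_one_left := fun t => by simp [F, e.left_inv (hp t).1]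
      prop' := by
        rintro t u (rfl | rfl)
        · simp [F, q, hb0, hx']
        · simp [F, q, hb1, hy'] }

/-- A Lebesgue subdivision cuts the path into finitely many pieces, each inside a coordinate ball.
Each piece is smoothed in its ball, and the results are concatenated. -/
theorem hasSmoothRep [IsManifold (𝓡 2) ∞ M] {x y : M} (p : Path x y) : HasSmoothRep p := by
  have hball (m : M) : ∃ r > 0, Metric.ball (chartAt Plane m m) r ⊆ (chartAt Plane m).target :=
    Metric.isOpen_iff.1 (chartAt Plane m).open_target _ (mem_chart_target Plane m)
  choose r hr hrt using hball
  let U : M → Set M := fun m =>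
    (chartAt Plane m).source ∩ chartAt Plane m ⁻¹' Metric.ball (chartAt Plane m m) (r m)
  have hU (m : M) : IsOpen (U m) := (chartAt Plane m).isOpen_inter_preimage Metric.isOpen_ball
  obtain ⟨t, ht0, htm, ⟨n, hn⟩, ht⟩ := exists_monotone_Icc_subset_open_cover_unitInterval
    (c := fun m => p ⁻¹' U m) (fun m => (hU m).preimage p.continuous)
    fun u _ => mem_iUnion.2 ⟨p u, mem_chart_source Plane _, Metric.mem_ball_self (hr _)⟩
  have hstep (k : ℕ) : HasSmoothRep (p.subpath (t k) (t (k + 1))) := by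
    obtain ⟨m, hm⟩ := ht k
    refine hasSmoothRep_of_chart m (convex_ball _ _) (hrt m) _ fun u => ?_
    have : p.subpath (t k) (t (k + 1)) u ∈ p '' Icc (t k) (t (k + 1)) := by
      rw [← Path.range_subpath_of_le p _ _ (htm k.le_succ)]
      exact mem_range_self u
    obtain ⟨v, hv, hv'⟩ := this
    rw [← hv']
    exact hm hv
  have hind (k : ℕ) : HasSmoothRep (p.subpath (t 0) (t k)) := by
    induction k with
    | zero =>
      rw [Path.subpath_self]
      exact hasSmoothRep_refl _
    | succ k ih => exact (ih.trans (hstep k)).congr ⟨Path.Homotopy.subpathTransSubpath p _ _ _⟩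
  have h := hind n
  rw [ht0, hn n le_rfl, Path.subpath_zero_one] at h
  exact h.of_cast

end SmoothPaths
end ClosedSurface

/-! ### A non-contractible loop, and pinching along a curve. -/

namespace ClosedSurface

open MeasureTheory Set Filter Topology

/-- If every loop were contractible, `π₁` would be trivial, hence so would `Hom(π₁, 𝔽₂)`. But the
first Betti number is positive in both cases of the definition of the genus. -/
lemma exists_loop_not_homotopic {X : Type*} [TopologicalSpace X] [ChartedSpace Plane X] [Nonempty X]
    (h : 2 ≤ genus X) :
    ∃ (x : X) (p : Path x x), ¬ p.Homotopic (Path.refl x) := by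
  have hb : 0 < bettiOne X := by
    rw [genus] at h
    split_ifs at h <;> omega
  by_contra! hcon
  have hsub : Subsingleton (FundamentalGroup X (Classical.arbitrary X)) := by
    refine ⟨fun a b => ?_⟩
    induction a using Path.Homotopic.Quotient.ind with
    | mk p =>
    induction b using Path.Homotopic.Quotient.ind with
    | mk q =>
    exact Path.Homotopic.Quotient.eq.2 ((hcon _ p).trans (hcon _ q).symm)
  have : Subsingleton (Additive (FundamentalGroup X (Classical.arbitrary X)) →+ ZMod 2) := by
    refine ⟨fun f g => AddMonoidHom.ext fun a => ?_⟩
    rw [show a = 0 from Subsingleton.elim (α := FundamentalGroup X (Classical.arbitrary X)) _ _,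
      map_zero, map_zero]
  rw [bettiOne, Module.finrank_zero_of_subsingleton] at hb
  exact hb.false

section Pinching

variable {M : Type*} [TopologicalSpace M] [T2Space M] [CompactSpace M]
  [ChartedSpace Plane M] [IsManifold (𝓡 2) ∞ M]

/-- A metric can be multiplied by a factor at most `1` which is small on the image of a `C^1` curve
while keeping at least a quarter of the area. -/
lemma exists_pinching_factor (σ : Metric M) {c : ℝ → M} (hc : ContMDiff 𝓘(ℝ, ℝ) (𝓡 2) 1 c)
    {δ : ℝ} (hδ : 0 < δ) (hδ1 : δ ≤ 1) :
    ∃ (f : M → ℝ) (hf : ContMDiff (𝓡 2) 𝓘(ℝ, ℝ) ∞ f) (hpos : ∀ p, 0 < f p),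
      (∀ p, f p ≤ 1) ∧ (∀ t ∈ Icc (0 : ℝ) 1, f (c t) = δ) ∧
      area σ ≤ 4 * area (scale σ f hf hpos) := by
  obtain ⟨u, hu, hu01, hu0, -⟩ := exists_contMDiff_zero_iff_one_iff_of_isClosed (𝓡 2) (n := ⊤)
    (isCompact_Icc.image (f := c) (s := Icc 0 1) hc.continuous).isClosed isClosed_empty
    (disjoint_empty _)
  have h0 (p : M) : 0 ≤ u p := (hu01 (mem_range_self p)).1
  have h1 (p : M) : u p ≤ 1 := (hu01 (mem_range_self p)).2
  have hq0 (n : ℕ) (p : M) : 0 ≤ (1 - u p) ^ n := pow_nonneg (sub_nonneg.2 (h1 p)) n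
  have hq1 (n : ℕ) (p : M) : (1 - u p) ^ n ≤ 1 :=
    pow_le_one₀ (sub_nonneg.2 (h1 p)) (by linarith [h0 p])
  -- As `u` vanishes exactly on the compact image of `[0, 1]`, `f n` equals `δ` there and increases
  -- to `1` elsewhere.
  let f : ℕ → M → ℝ := fun n p => 1 - (1 - δ) * (1 - u p) ^ n
  have hf (n : ℕ) : ContMDiff (𝓡 2) 𝓘(ℝ, ℝ) ∞ (f n) := by
    have h : ContDiff ℝ ∞ fun s : ℝ => 1 - (1 - δ) * (1 - s) ^ n := by fun_prop
    exact h.contMDiff.comp hu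
  have hpos (n : ℕ) (p : M) : 0 < f n p := by
    have := mul_le_mul_of_nonneg_left (hq1 n p) (sub_nonneg.2 hδ1)
    simp only [f]
    linarith
  have hle (n : ℕ) (p : M) : f n p ≤ 1 := by
    have := mul_nonneg (sub_nonneg.2 hδ1) (hq0 n p)
    simp only [f]
    linarith
  have hcurve (n : ℕ) (t : ℝ) (ht : t ∈ Icc (0 : ℝ) 1) : f n (c t) = δ := by
    simp [f, (hu0 _).1 (mem_image_of_mem c ht)]
  have hlim := tendsto_area_scale σ f hf hpos (K := c '' Icc 0 1) (fun p m n hmn => by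
      have := mul_le_mul_of_nonneg_left
        (pow_le_pow_of_le_one (sub_nonneg.2 (h1 p)) (by linarith [h0 p]) hmn) (sub_nonneg.2 hδ1)
      simp only [f]
      linarith)
    (fun x => measure_mono_null (inter_subset_inter_right _ (preimage_mono (image_subset_range _ _)))
      (volume_chart_preimage_range_eq_zero hc x))
    (fun p hp => by
      have hup : 0 < u p := (h0 p).lt_of_ne fun h => hp ((hu0 p).2 h.symm)
      have h := tendsto_pow_atTop_nhds_zero_of_lt_one (sub_nonneg.2 (h1 p)) (by linarith)
      simpa [f] using (h.const_mul (1 - δ)).const_sub 1)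
  have : ∃ n, area σ ≤ 4 * area (scale σ (f n) (hf n) (hpos n)) := by
    rcases eq_or_ne (area σ) 0 with hA | hA
    · exact ⟨0, hA ▸ zero_le⟩
    · have h4 : area σ < 4 * area σ := by
        calc area σ = 1 * area σ := (one_mul _).symm
          _ < 4 * area σ := ENNReal.mul_lt_mul_left hA (area_lt_top σ).ne (by norm_num)
      exact (((ENNReal.Tendsto.const_mul hlim (Or.inr (by simp))).eventually
        (lt_mem_nhds h4)).exists).imp fun _ h => h.le
  obtain ⟨n, hn⟩ := this
  exact ⟨f n, hf n, hpos n, hle n, hcurve n, hn⟩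

end Pinching

end ClosedSurface

end

/-! ### Assembling the metric. -/

theorem lemma4p1 {M : Type*} [TopologicalSpace M] [T2Space M] [CompactSpace M] [ConnectedSpace M]
    [ChartedSpace ClosedSurface.Plane M] [IsManifold (𝓡 2) ∞ M]
    (hM : 2 ≤ ClosedSurface.genus M)
    (σ : ClosedSurface.Metric M) (hσ : ClosedSurface.IsHyperbolic σ)
    (ε : ℝ) (hε : 0 < ε) :
    ∃ g : ClosedSurface.Metric M,
      ClosedSurface.IsConformal g σ ∧
      ClosedSurface.area g = ClosedSurface.area σ ∧
      ClosedSurface.systole g ≤ ENNReal.ofReal ε ∧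
      ClosedSurface.diam g ≤ 2 * ClosedSurface.diam σ := by
  open ClosedSurface in
  obtain ⟨x, p, hp⟩ := exists_loop_not_homotopic hM
  obtain ⟨q, c, hc, hqc, hqp⟩ := hasSmoothRep p
  have hq : ¬ q.Homotopic (Path.refl x) := fun h => hp (hqp.symm.trans h)
  have hqs : ContMDiff (𝓡∂ 1) (𝓡 2) 1 q :=
    (hc.comp contMDiff_subtypeVal_Icc).congr hqc
  have hL := (length_lt_top σ q hc hqc).ne
  set L := (length σ q).toReal with hLdef
  have hL0 : 0 ≤ L := ENNReal.toReal_nonneg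
  -- `2 * η * L` will bound the length of the loop; `L + 1` avoids dividing by zero.
  obtain ⟨η, hη, hη1, hηL⟩ : ∃ η : ℝ, 0 < η ∧ η ≤ 1 ∧ 2 * η * L ≤ ε := by
    refine ⟨min 1 (ε / (2 * (L + 1))), by positivity, min_le_left _ _, ?_⟩
    have h1 : min 1 (ε / (2 * (L + 1))) * (2 * (L + 1)) ≤ ε :=
      (le_div_iff₀ (by positivity)).1 (min_le_right _ _)
    have h2 : 0 ≤ min 1 (ε / (2 * (L + 1))) := by positivity
    nlinarith
  obtain ⟨f, hf, hpos, hle, hcurve, harea⟩ :=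
    exists_pinching_factor σ hc (pow_pos hη 2) (pow_le_one₀ hη.le hη1)
  have hBA := area_scale_le σ f hf hpos hle
  -- `k` is the ratio of the two areas, at most `4` by `harea`; if the area of `σ` is zero, `k = 1`
  -- works.
  obtain ⟨k, hk, hk4, hkA⟩ : ∃ k : ℝ, 0 < k ∧ k ≤ 2 ^ 2 ∧
      ENNReal.ofReal k * area (scale σ f hf hpos) = area σ := by
    have hAtop := (area_lt_top σ).ne
    rcases eq_or_ne (area σ) 0 with hA | hA
    · refine ⟨1, one_pos, by norm_num, ?_⟩
      rw [hA] at hBA ⊢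
      simp [le_antisymm hBA bot_le]
    · have hB : area (scale σ f hf hpos) ≠ 0 := fun h => hA (by simpa [h] using harea)
      have hBtop := ne_top_of_le_ne_top hAtop hBA
      have hq4 : area σ / area (scale σ f hf hpos) ≤ 4 := ENNReal.div_le_of_le_mul harea
      have hqtop := ne_top_of_le_ne_top (by simp) hq4
      refine ⟨_, ENNReal.toReal_pos (ENNReal.div_pos hA hBtop).ne' hqtop, ?_, ?_⟩
      · refine (ENNReal.toReal_mono (by simp) hq4).trans ?_
        norm_num
      · rw [ENNReal.ofReal_toReal hqtop, ENNReal.div_mul_cancel hB hBtop]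
  have hkpos (p : M) : 0 < k * f p := mul_pos hk (hpos p)
  have hkf : ContMDiff (𝓡 2) 𝓘(ℝ, ℝ) ∞ fun p => k * f p := contMDiff_const.mul hf
  refine ⟨scale σ _ hkf hkpos, isConformal_scale _ _ _ _, ?_, ?_, ?_⟩
  · rw [area_scale_const_mul σ f hf hpos hk, hkA]
  · refine (systole_le_length _ hqs hq).trans ?_
    refine (length_scale_le σ _ hkf hkpos q (c := 2 * η) (by positivity) fun t => ?_).trans ?_
    · rw [hqc, hcurve t t.2, mul_pow]
      exact mul_le_mul_of_nonneg_right hk4 (sq_nonneg η)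
    · rw [← ENNReal.ofReal_toReal hL, ← ENNReal.ofReal_mul (by positivity)]
      exact ENNReal.ofReal_le_ofReal hηL
  · have h := diam_scale_le σ _ hkf hkpos two_pos fun p =>
      (mul_le_of_le_one_right hk.le (hle p)).trans hk4
    simpa using h
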